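/- Let $X=\mathbb R^L_+$, and write $x\ge y$ for the coordinatewise order, $x>y$ for $x\ge y$, $x\ne y$, and $x\gg 0$ when all coordinates are positive. Let $\succeq$ be a complete and transitive preference relation on $X$, with strict part $\succ$ and indifference $\sim$, and put $R_+(z)=\{w\in X: w\succeq z\}$. Assume that $\succeq$ is - continuous: for every $x\in X$ the sets $\{y\in X:y\succeq x\}$ and $\{y\in X:x\succeq y\}$ are closed; - monotone: $x>y$ implies $x\succ y$; - strictly convex: $x\succeq y$, $x\neq y$ imply $\lambda x+(1-\lambda)y\succ y$ for all $\lambda\in(0,1)$; - Lipschitzian: for every $r>0$ there are $H>0$ and $\epsilon>0$ such that, whenever $x,y,z\in X$ have all coordinates in $[\frac1{1+r},1+r]$, $x\sim y$ and $\|x-z\|<\epsilon$, then $\delta(x,R_+(z))\le H\,\delta(y,R_+(z))$, where $\delta(x,A)=\inf_{w\in A}\|x-w\|$ and $\|\cdot\|$ is the Euclidean norm. Let $(p_k)_{k\ge1}$ be a sequence of prices in $\mathbb R^L_{++}$ that is dense in $\mathbb R^L_{++}$, and let $x_k$ be the demand at $p_k$, that is, the $\succeq$-best bundle in the budget set $\{x\in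 X: p_k\cdot x\le 1\}$. For $x,y\in\mathbb R^L_{++}$ say that $x$ is strictly revealed preferred to $y$ through $n$ observations, $x\succ^{R_n}y$, if there are $k\ge1$ and indices $i_1,\dots,i_{k+1}\in\{1,\dots,n\}$ such that $x\ge x_{i_1}$, $\;p_{i_j}\cdot x_{i_{j+1}}<p_{i_j}\cdot x_{i_j}$ for all $j=1,\dots,k$, and $x_{i_{k+1}}\ge y$. Then, for all $x,y\in\mathbb R^L_{++}$: $x\succ y$ if and only if there is some $n$ such that $x\succ^{R_n}y$. -/

import Mathlib

/-- Commodity (and price) space with `L` goods, carrying the Euclidean norm. -/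
abbrev Bundle (L : ℕ) : Type := EuclideanSpace ℝ (Fin L)

namespace Bundle

/-- The consumption set: bundles with nonnegative coordinates. -/
def consumptionSet (L : ℕ) : Set (Bundle L) := {x | ∀ l, 0 ≤ x l}

/-- Vectors with all coordinates positive: the strictly positive price vectors, and also the
interior of the consumption set. -/
def positiveOrthant (L : ℕ) : Set (Bundle L) := {x | ∀ l, 0 < x l}

/-- Coordinatewise (weak) inequality `x ≤ y`. -/
def WeakLE {L : ℕ} (x y : Bundle L) : Prop := ∀ l, x l ≤ y l

/-- The compact box of bundles with all coordinates between `1 / (1 + r)` and `1 + r`. -/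
def box (L : ℕ) (r : ℝ) : Set (Bundle L) := {w | ∀ l, 1 / (1 + r) ≤ w l ∧ w l ≤ 1 + r}

/-- `R x y` (read: `x` is weakly preferred to `y`) is a preference relation on the consumption set:
complete and transitive there. Its values outside the consumption set are never used. -/
structure IsPreference {L : ℕ} (R : Bundle L → Bundle L → Prop) : Prop where
  total : ∀ x ∈ consumptionSet L, ∀ y ∈ consumptionSet L, R x y ∨ R y x
  trans : ∀ x ∈ consumptionSet L, ∀ y ∈ consumptionSet L, ∀ z ∈ consumptionSet L,
    R x y → R y z → R x z

/-- Strict preference. -/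
def StrictPref {L : ℕ} (R : Bundle L → Bundle L → Prop) (x y : Bundle L) : Prop :=
  R x y ∧ ¬ R y x

/-- Indifference. -/
def Indiff {L : ℕ} (R : Bundle L → Bundle L → Prop) (x y : Bundle L) : Prop :=
  R x y ∧ R y x

/-- Bundles weakly preferred to `x`. -/
def upperContour {L : ℕ} (R : Bundle L → Bundle L → Prop) (x : Bundle L) : Set (Bundle L) :=
  {y | y ∈ consumptionSet L ∧ R y x}

/-- Bundles to which `x` is weakly preferred. -/
def lowerContour {L : ℕ} (R : Bundle L → Bundle L → Prop) (x : Bundle L) : Set (Bundle L) :=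
  {y | y ∈ consumptionSet L ∧ R x y}

/-- Continuity: upper and lower contour sets are closed (the consumption set being closed, it does
not matter whether relatively to it or in the whole space). -/
def ContinuousPref {L : ℕ} (R : Bundle L → Bundle L → Prop) : Prop :=
  ∀ x ∈ consumptionSet L, IsClosed (upperContour R x) ∧ IsClosed (lowerContour R x)

/-- Monotonicity: more of some good and no less of any other is strictly preferred. -/
def MonotonePref {L : ℕ} (R : Bundle L → Bundle L → Prop) : Prop :=
  ∀ x ∈ consumptionSet L, ∀ y ∈ consumptionSet L, WeakLE y x → x ≠ y → StrictPref R x y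

/-- Strict convexity of preferences. -/
def StrictlyConvexPref {L : ℕ} (R : Bundle L → Bundle L → Prop) : Prop :=
  ∀ x ∈ consumptionSet L, ∀ y ∈ consumptionSet L, R x y → x ≠ y →
    ∀ t : ℝ, 0 < t → t < 1 → StrictPref R (t • x + (1 - t) • y) y

/-- Lipschitzian preferences. The upper contour set of `z` contains `z`, so the distances below
are never distances to the empty set. -/
def LipschitzianPref {L : ℕ} (R : Bundle L → Bundle L → Prop) : Prop :=
  ∀ r : ℝ, 0 < r → ∃ H : ℝ, 0 < H ∧ ∃ ε : ℝ, 0 < ε ∧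
    ∀ x ∈ box L r, ∀ y ∈ box L r, ∀ z ∈ box L r, Indiff R x y → ‖x - z‖ < ε →
      Metric.infDist x (upperContour R z) ≤ H * Metric.infDist y (upperContour R z)

/-- The budget set at prices `p`, income being normalized to one. -/
def budget {L : ℕ} (p : Bundle L) : Set (Bundle L) :=
  {x | x ∈ consumptionSet L ∧ inner ℝ p x ≤ 1}

/-- Walrasian demand at prices `p`: the best bundles of the budget set. -/
def demand {L : ℕ} (R : Bundle L → Bundle L → Prop) (p : Bundle L) : Set (Bundle L) :=
  {x | x ∈ budget p ∧ ∀ y ∈ budget p, R x y}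

/-- `a` is strictly revealed preferred to `b` through the first `n` of the observations
`(p 0, x 0), (p 1, x 1), …`: there is a chain of observations `i 0, …, i k`, all among the
first `n`, with `k ≥ 1` strict comparisons, that starts weakly below `a` and ends weakly above `b`. -/
def StrictlyRevealedPreferred {L : ℕ} (p x : ℕ → Bundle L) (n : ℕ) (a b : Bundle L) : Prop :=
  ∃ (k : ℕ) (i : ℕ → ℕ), 1 ≤ k ∧ (∀ j ≤ k, i j < n) ∧
    WeakLE (x (i 0)) a ∧
    (∀ j < k, inner ℝ (p (i j)) (x (i (j + 1))) < inner ℝ (p (i j)) (x (i j))) ∧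
    WeakLE b (x (i k))

end Bundle

open Filter Topology

namespace Bundle

variable {L : ℕ} {u : Bundle L → ℝ}

/-! Soundness is the standard argument: a bundle strictly cheaper than the demanded one leaves
income to spend, so it is strictly worse.

For completeness, represent the preference by a utility `u` normalized on the diagonal. Supporting
prices exist, are strictly positive, and have a closed graph. Since prices are dense and demand
converges to `z` along prices tending to a rescaled supporting price (`tendsto_demand`), a finite
chain of `Undercut` relations can be shadowed by a chain of observations. Shrinking `a` and
enlarging `b` slightly beforehand absorbs the errors.

The chain of undercuttings follows a curve from `a` to `b`, obtained by rescaling the segment so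
that utility falls linearly (`reflTransGen_undercut_of_lt`). The Lipschitz hypothesis makes this
fall worth a fraction at least `κ * (t - s)` of the bundle `z s`. Hence, at a price supporting the
later bundle, the later bundle is cheaper by an amount of order `t - s`. Undercutting needs a price
of the earlier bundle instead. Supporting prices of nearby bundles accumulate at supporting prices
and displacement is `O(t - s)`, so changing the price costs only `o(t - s)` in the limit. Nearby
points of the curve therefore undercut one another, and a supremum argument makes the chain finite
(`reflTransGen_undercut_of_curve`). -/

/-- The bundle with one unit of each good. -/
noncomputable def ones (L : ℕ) : Bundle L := WithLp.toLp 2 fun _ => 1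

@[simp] lemma ones_apply (l : Fin L) : ones L l = 1 := rfl

lemma inner_eq_sum (p x : Bundle L) : inner ℝ p x = ∑ l, p l * x l := by
  simp [PiLp.inner_apply, mul_comm]

lemma consumptionSet_of_pos {x : Bundle L} (hx : x ∈ positiveOrthant L) : x ∈ consumptionSet L :=
  fun l => (hx l).le

lemma smul_mem {x : Bundle L} (hx : x ∈ consumptionSet L) {s : ℝ} (hs : 0 ≤ s) :
    s • x ∈ consumptionSet L := fun l => mul_nonneg hs (hx l)

lemma smul_pos_mem {x : Bundle L} (hx : x ∈ positiveOrthant L) {s : ℝ} (hs : 0 < s) :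
    s • x ∈ positiveOrthant L := fun l => mul_pos hs (hx l)

lemma add_mem {x y : Bundle L} (hx : x ∈ consumptionSet L) (hy : y ∈ consumptionSet L) :
    x + y ∈ consumptionSet L := fun l => add_nonneg (hx l) (hy l)

lemma ones_mem : ones L ∈ positiveOrthant L := fun _ => one_pos

lemma isClosed_consumptionSet : IsClosed (consumptionSet L) := by
  have : consumptionSet L = ⋂ l, {x : Bundle L | 0 ≤ x l} := by
    ext x; simp [consumptionSet]
  rw [this]
  exact isClosed_iInter fun l => isClosed_le continuous_const (by fun_prop)

lemma isOpen_positiveOrthant : IsOpen (positiveOrthant L) := by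
  have : positiveOrthant L = ⋂ l, {x : Bundle L | 0 < x l} := by
    ext x; simp [positiveOrthant]
  rw [this]
  exact isOpen_iInter_of_finite fun l => isOpen_lt continuous_const (by fun_prop)

lemma inner_pos_of_pos [Nonempty (Fin L)] {p x : Bundle L} (hp : p ∈ positiveOrthant L)
    (hx : x ∈ positiveOrthant L) : 0 < inner ℝ p x := by
  rw [inner_eq_sum]
  exact Finset.sum_pos (fun l _ => mul_pos (hp l) (hx l)) Finset.univ_nonempty

/-! ### Utility representation -/

/-- A continuous, strictly monotone and strictly quasiconcave utility function, normalized on the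
diagonal. -/
structure IsRegularUtility (u : Bundle L → ℝ) : Prop where
  continuousOn : ContinuousOn u (consumptionSet L)
  lt_of_weakLE : ∀ x ∈ consumptionSet L, ∀ y ∈ consumptionSet L, WeakLE y x → x ≠ y → u y < u x
  lt_convex : ∀ x ∈ consumptionSet L, ∀ y ∈ consumptionSet L, u y ≤ u x → x ≠ y →
    ∀ t : ℝ, 0 < t → t < 1 → u y < u (t • x + (1 - t) • y)
  diag : ∀ s : ℝ, 0 ≤ s → u (s • ones L) = s

/-- The diagonal ray is connected and is covered by two closed sets, the points at least as good as
`x` and those at most as good, so these sets meet. -/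
lemma exists_indiff_diag [Nonempty (Fin L)] {R : Bundle L → Bundle L → Prop}
    (hR : IsPreference R) (hcont : ContinuousPref R) (hmono : MonotonePref R)
    {x : Bundle L} (hx : x ∈ consumptionSet L) : ∃ s : ℝ, 0 ≤ s ∧ Indiff R x (s • ones L) := by
  obtain ⟨l₀, hl₀⟩ := Finite.exists_max x
  have hray : Continuous fun s : ℝ => s • ones L := by fun_prop
  have hle : ∀ y ∈ consumptionSet L, ∀ z ∈ consumptionSet L, WeakLE z y → R y z := by
    intro y hy z hz h
    by_cases hyz : y = z
    · subst hyz; exact (hR.total y hy y hy).elim id id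
    · exact (hmono y hy z hz h hyz).1
  have hmem : ∀ s : ℝ, 0 ≤ s → s • ones L ∈ consumptionSet L := fun s hs =>
    smul_mem (consumptionSet_of_pos ones_mem) hs
  obtain ⟨hU, hD⟩ := hcont x hx
  have := isPreconnected_closed_iff.1 (isPreconnected_Ici (a := (0:ℝ))) _ _
    (hU.preimage hray) (hD.preimage hray) ?_ ?_ ?_
  · obtain ⟨s, hs, h1, h2⟩ := this
    exact ⟨s, hs, h2.2, h1.2⟩
  · intro s hs
    rcases hR.total x hx _ (hmem s hs) with h | h
    · exact Or.inr ⟨hmem s hs, h⟩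
    · exact Or.inl ⟨hmem s hs, h⟩
  · refine ⟨x l₀, hx l₀, hmem _ (hx l₀), hle _ (hmem _ (hx l₀)) _ hx fun l => ?_⟩
    simpa using hl₀ l
  · refine ⟨0, Set.self_mem_Ici, hmem 0 le_rfl, hle _ hx _ (hmem 0 le_rfl) fun l => ?_⟩
    simpa using hx l

/-- The utility of `x` is the level of the diagonal bundle indifferent to it. Continuity holds
because the preimages of open half-lines are complements of contour sets of diagonal bundles. -/
theorem exists_isRegularUtility [Nonempty (Fin L)] {R : Bundle L → Bundle L → Prop}
    (hR : IsPreference R) (hcont : ContinuousPref R) (hmono : MonotonePref R)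
    (hconv : StrictlyConvexPref R) :
    ∃ u : Bundle L → ℝ, IsRegularUtility u ∧
      ∀ x ∈ consumptionSet L, ∀ y ∈ consumptionSet L, R x y ↔ u y ≤ u x := by
  have hmem : ∀ s : ℝ, 0 ≤ s → s • ones L ∈ consumptionSet L := fun s hs =>
    smul_mem (consumptionSet_of_pos ones_mem) hs
  have hstrict : ∀ s t : ℝ, 0 ≤ s → s < t → StrictPref R (t • ones L) (s • ones L) := by
    intro s t hs hst
    refine hmono _ (hmem t (hs.trans hst.le)) _ (hmem s hs) (fun l => by simpa using hst.le) ?_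
    intro h
    have := congrArg (fun x : Bundle L => x (Classical.arbitrary (Fin L))) h
    simp at this
    exact hst.ne' this
  have hrefl : ∀ y ∈ consumptionSet L, R y y := fun y hy => (hR.total y hy y hy).elim id id
  have hdiag : ∀ s t : ℝ, 0 ≤ s → 0 ≤ t → (R (s • ones L) (t • ones L) ↔ t ≤ s) := by
    intro s t hs ht
    constructor
    · intro h
      by_contra! hst
      exact (hstrict s t hs hst).2 h
    · intro h
      rcases h.eq_or_lt with rfl | h
      · exact hrefl _ (hmem _ hs)
      · exact (hstrict t s ht h).1
  have hex : ∀ x : Bundle L, ∃ s : ℝ, x ∈ consumptionSet L → 0 ≤ s ∧ Indiff R x (s • ones L) := by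
    intro x
    by_cases hx : x ∈ consumptionSet L
    · obtain ⟨s, hs⟩ := exists_indiff_diag hR hcont hmono hx
      exact ⟨s, fun _ => hs⟩
    · exact ⟨0, fun h => absurd h hx⟩
  choose u hu using hex
  have hrep : ∀ x ∈ consumptionSet L, ∀ y ∈ consumptionSet L, R x y ↔ u y ≤ u x := by
    intro x hx y hy
    obtain ⟨hx0, hx1, hx2⟩ := hu x hx
    obtain ⟨hy0, hy1, hy2⟩ := hu y hy
    rw [← hdiag _ _ hx0 hy0]
    constructor
    · intro h
      exact hR.trans _ (hmem _ hx0) _ hx _ (hmem _ hy0) hx2 (hR.trans _ hx _ hy _ (hmem _ hy0) h hy1)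
    · intro h
      exact hR.trans _ hx _ (hmem _ hx0) _ hy hx1
        (hR.trans _ (hmem _ hx0) _ (hmem _ hy0) _ hy h hy2)
  have hstr : ∀ x ∈ consumptionSet L, ∀ y ∈ consumptionSet L, StrictPref R x y → u y < u x := by
    intro x hx y hy h
    by_contra! h'
    exact h.2 ((hrep y hy x hx).2 h')
  have hud : ∀ s : ℝ, 0 ≤ s → u (s • ones L) = s := by
    intro s hs
    obtain ⟨h0, h1, h2⟩ := hu _ (hmem s hs)
    exact le_antisymm ((hdiag _ _ hs h0).1 h1) ((hdiag _ _ h0 hs).1 h2)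
  refine ⟨u, ⟨?_, ?_, ?_, hud⟩, hrep⟩
  · intro x hx
    refine tendsto_order.2 ⟨fun a ha => ?_, fun a ha => ?_⟩
    · by_cases h0 : a < 0
      · filter_upwards [self_mem_nhdsWithin] with y hy
        exact h0.trans_le (hu y hy).1
      · push Not at h0
        have hop := (hcont _ (hmem a h0)).2.isOpen_compl
        have hxin : x ∈ (lowerContour R (a • ones L))ᶜ := fun h => by
          have := (hrep _ (hmem a h0) x hx).1 h.2
          rw [hud a h0] at this
          exact absurd ha this.not_gt
        filter_upwards [self_mem_nhdsWithin, mem_nhdsWithin_of_mem_nhds (hop.mem_nhds hxin)]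
          with y hy hy'
        by_contra! h
        exact hy' ⟨hy, (hrep _ (hmem a h0) y hy).2 (by rwa [hud a h0])⟩
    · have h0 : 0 ≤ a := (hu x hx).1.trans ha.le
      have hop := (hcont _ (hmem a h0)).1.isOpen_compl
      have hxin : x ∈ (upperContour R (a • ones L))ᶜ := fun h => by
        have := (hrep x hx _ (hmem a h0)).1 h.2
        rw [hud a h0] at this
        exact absurd ha this.not_gt
      filter_upwards [self_mem_nhdsWithin, mem_nhdsWithin_of_mem_nhds (hop.mem_nhds hxin)]
        with y hy hy'
      by_contra! h
      exact hy' ⟨hy, (hrep y hy _ (hmem a h0)).2 (by rwa [hud a h0])⟩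
  · exact fun x hx y hy h hne => hstr x hx y hy (hmono x hx y hy h hne)
  · intro x hx y hy h hne t ht0 ht1
    exact hstr _ (add_mem (smul_mem hx ht0.le) (smul_mem hy (by linarith))) _ hy
      (hconv x hx y hy ((hrep x hx y hy).2 h) hne t ht0 ht1)

/-! ### Utility along rays -/

namespace IsRegularUtility

lemma mono (hu : IsRegularUtility u) {x y : Bundle L} (hx : x ∈ consumptionSet L)
    (hy : y ∈ consumptionSet L) (h : WeakLE y x) : u y ≤ u x := by
  by_cases hxy : x = y
  · rw [hxy]
  · exact (hu.lt_of_weakLE x hx y hy h hxy).le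

lemma lt_of_forall_lt [Nonempty (Fin L)] (hu : IsRegularUtility u) {x y : Bundle L}
    (hy : y ∈ consumptionSet L) (h : ∀ l, y l < x l) : u y < u x := by
  refine hu.lt_of_weakLE x (fun l => (hy l).trans (h l).le) y hy (fun l => (h l).le) ?_
  rintro rfl
  exact (h (Classical.arbitrary _)).false

lemma convex_superlevel (hu : IsRegularUtility u) (c : ℝ) :
    Convex ℝ {y | y ∈ consumptionSet L ∧ c ≤ u y} := by
  intro x hx y hy s t hs ht hst
  refine ⟨add_mem (smul_mem hx.1 hs) (smul_mem hy.1 ht), ?_⟩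
  rcases hs.eq_or_lt with rfl | hs
  · obtain rfl : t = 1 := by linarith
    simpa using hy.2
  rcases ht.eq_or_lt with rfl | ht
  · obtain rfl : s = 1 := by linarith
    simpa using hx.2
  by_cases hxy : x = y
  · subst hxy
    rw [← add_smul, hst, one_smul]; exact hx.2
  rcases le_total (u y) (u x) with h | h
  · have := hu.lt_convex x hx.1 y hy.1 h hxy s hs (by linarith)
    rw [show 1 - s = t by linarith] at this
    exact hy.2.trans this.le
  · have := hu.lt_convex y hy.1 x hx.1 h (Ne.symm hxy) t ht (by linarith)
    rw [show 1 - t = s by linarith, add_comm] at this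
    exact hx.2.trans this.le

lemma continuousOn_ray (hu : IsRegularUtility u) {x : Bundle L} (hx : x ∈ consumptionSet L) :
    ContinuousOn (fun s : ℝ => u (s • x)) (Set.Ici 0) :=
  hu.continuousOn.comp (by fun_prop) fun _ hs => smul_mem hx hs

/-- Used to sharpen weak cost inequalities: a strictly better bundle stays better after a slight
radial shrinking, which lowers its cost whenever that is positive. -/
lemma exists_smul_lt (hu : IsRegularUtility u) {x : Bundle L} (hx : x ∈ consumptionSet L)
    {c : ℝ} (hc : c < u x) : ∃ s : ℝ, 0 < s ∧ s < 1 ∧ c < u (s • x) := by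
  have h1 : Tendsto (fun s : ℝ => u (s • x)) (𝓝[<] 1) (𝓝 (u x)) := by
    have := (hu.continuousOn_ray hx).continuousAt (x := 1) (Ici_mem_nhds one_pos)
    simpa using this.tendsto.mono_left nhdsWithin_le_nhds
  have h2 : ∀ᶠ s : ℝ in 𝓝[<] 1, 0 < s := mem_nhdsWithin_of_mem_nhds (Ioi_mem_nhds one_pos)
  obtain ⟨s, hs, hs0, hs1⟩ := ((h1.eventually (lt_mem_nhds hc)).and
    (h2.and self_mem_nhdsWithin)).exists
  exact ⟨s, hs0, hs1, hs⟩

lemma exists_one_lt_smul_lt (hu : IsRegularUtility u) {x : Bundle L} (hx : x ∈ consumptionSet L)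
    {c : ℝ} (hc : u x < c) : ∃ s : ℝ, 1 < s ∧ u (s • x) < c := by
  have h1 : Tendsto (fun s : ℝ => u (s • x)) (𝓝[>] 1) (𝓝 (u x)) := by
    have := (hu.continuousOn_ray hx).continuousAt (x := 1) (Ici_mem_nhds one_pos)
    simpa using this.tendsto.mono_left nhdsWithin_le_nhds
  obtain ⟨s, hs, hs1⟩ := ((h1.eventually (gt_mem_nhds hc)).and self_mem_nhdsWithin).exists
  exact ⟨s, hs1, hs⟩

lemma exists_smul_eq [Nonempty (Fin L)] (hu : IsRegularUtility u) {c : Bundle L}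
    (hc : c ∈ positiveOrthant L) {v : ℝ} (hv : 0 < v) : ∃ s : ℝ, 0 < s ∧ u (s • c) = v := by
  obtain ⟨l₀, hl₀⟩ := Finite.exists_min c
  have hcX := consumptionSet_of_pos hc
  have h0 : u ((0 : ℝ) • c) = 0 := by
    rw [zero_smul, ← zero_smul ℝ (ones L)]; exact hu.diag 0 le_rfl
  have hs : 0 ≤ v / c l₀ := (div_pos hv (hc l₀)).le
  have h1 : v ≤ u ((v / c l₀) • c) := by
    refine (hu.diag v hv.le).symm.trans_le ?_
    refine hu.mono (smul_mem hcX hs) (smul_mem (consumptionSet_of_pos ones_mem) hv.le) fun l => ?_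
    have := mul_le_mul_of_nonneg_left (hl₀ l) hs
    rw [div_mul_cancel₀ _ (hc l₀).ne'] at this
    simpa using this
  obtain ⟨s, hs', hsv⟩ := intermediate_value_Icc hs
    ((hu.continuousOn_ray hcX).mono Set.Icc_subset_Ici_self) ⟨h0.trans_le hv.le, h1⟩
  refine ⟨s, lt_of_le_of_ne hs'.1 ?_, hsv⟩
  rintro rfl
  simp only [h0] at hsv
  exact hv.ne hsv

lemma le_of_smul_le_smul [Nonempty (Fin L)] (hu : IsRegularUtility u) {c : Bundle L}
    (hc : c ∈ positiveOrthant L) {s t : ℝ} (hs : 0 ≤ s) :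
    u (t • c) ≤ u (s • c) → t ≤ s := by
  intro h
  by_contra! hst
  exact (hu.lt_of_forall_lt (smul_mem (consumptionSet_of_pos hc) hs)
    fun l => by simpa using mul_lt_mul_of_pos_right hst (hc l)).not_ge h

end IsRegularUtility

/-! ### Supporting prices -/

/-- The prices normalized to have coordinates summing to one. -/
def priceSimplex (L : ℕ) : Set (Bundle L) := {p | p ∈ consumptionSet L ∧ ∑ l, p l = 1}

/-- The normalized price vector `p` supports the upper contour set of `z`. -/
def IsSupportingPrice (u : Bundle L → ℝ) (p z : Bundle L) : Prop :=
  p ∈ priceSimplex L ∧ ∀ y ∈ consumptionSet L, u z ≤ u y → inner ℝ p z ≤ inner ℝ p y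

lemma isCompact_priceSimplex : IsCompact (priceSimplex L) := by
  have hcl : IsClosed (priceSimplex L) :=
    isClosed_consumptionSet.inter (isClosed_eq (by fun_prop) continuous_const)
  refine Metric.isCompact_of_isClosed_isBounded hcl ?_
  refine (Metric.isBounded_closedBall (x := (0 : Bundle L)) (r := 1)).subset fun p hp => ?_
  rw [mem_closedBall_zero_iff, EuclideanSpace.norm_eq, Real.sqrt_le_one]
  calc ∑ l, ‖p l‖ ^ 2 ≤ ∑ l, p l := Finset.sum_le_sum fun l _ => by
        have h1 : p l ≤ 1 := hp.2 ▸ Finset.single_le_sum (fun i _ => hp.1 i) (Finset.mem_univ l)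
        rw [Real.norm_eq_abs, sq_abs]
        nlinarith [hp.1 l]
    _ = 1 := hp.2

lemma inner_pos_of_priceSimplex {p z : Bundle L} (hp : p ∈ priceSimplex L)
    (hz : z ∈ positiveOrthant L) : 0 < inner ℝ p z := by
  rw [inner_eq_sum]
  have hne : ∃ l, p l ≠ 0 := by
    by_contra! h
    have := hp.2
    simp [h] at this
  obtain ⟨l, hl⟩ := hne
  exact Finset.sum_pos' (fun i _ => mul_nonneg (hp.1 i) (hz i).le)
    ⟨l, Finset.mem_univ l, mul_pos (lt_of_le_of_ne (hp.1 l) (Ne.symm hl)) (hz l)⟩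

/-- Separate the convex upper contour set of `z` from the open cone of bundles strictly below `z` in
every coordinate, then normalize the functional by its value on `ones L`. -/
theorem IsRegularUtility.exists_isSupportingPrice [Nonempty (Fin L)] (hu : IsRegularUtility u)
    {z : Bundle L} (hz : z ∈ positiveOrthant L) : ∃ p, IsSupportingPrice u p z := by
  have hzX := consumptionSet_of_pos hz
  set s : Set (Bundle L) := {w | z - w ∈ positiveOrthant L}
  set t : Set (Bundle L) := {y | y ∈ consumptionSet L ∧ u z ≤ u y}
  have hs : Convex ℝ s := by
    intro x hx y hy a b ha hb hab l
    have h1 : 0 < z l - x l := hx l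
    have h2 : 0 < z l - y l := hy l
    change 0 < z l - (a * x l + b * y l)
    have : z l - (a * x l + b * y l) = a * (z l - x l) + b * (z l - y l) := by
      linear_combination (-z l) * hab
    rw [this]
    rcases ha.eq_or_lt with rfl | ha
    · obtain rfl : b = 1 := by linarith
      linarith
    · nlinarith [mul_pos ha h1, mul_nonneg hb h2.le]
  have hso : IsOpen s := isOpen_positiveOrthant.preimage (by fun_prop)
  have hdisj : Disjoint s t := by
    rw [Set.disjoint_left]
    intro w hw hwt
    refine (hu.lt_of_forall_lt (x := z) hwt.1 fun l => ?_).not_ge hwt.2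
    have h1 : 0 < z l - w l := hw l
    linarith
  obtain ⟨f, c, hfs, hft⟩ := geometric_hahn_banach_open hs hso (hu.convex_superlevel (u z)) hdisj
  have hsz : ∀ d ∈ positiveOrthant L, f z - f d < c := fun d hd => by
    rw [← map_sub]; exact hfs _ (by simpa [s] using hd)
  have hnn : ∀ d ∈ consumptionSet L, 0 ≤ f d := by
    intro d hd
    by_contra! hneg
    have h1 : ∀ n : ℝ, 0 < n → f z - f (ones L) - n * f d < c := by
      intro n hn
      have := hsz (ones L + n • d) fun l => by
        have := mul_nonneg hn.le (hd l)
        simp; linarith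
      simp only [map_add, map_smul, smul_eq_mul] at this
      linarith
    have hc := hft z ⟨hzX, le_rfl⟩
    -- With this multiple, `-n * f d` outweighs `f (ones L)` and leaves `-f d > 0` to spare,
    -- contradicting `c ≤ f z`.
    have h2 := h1 (|f (ones L)| / (-f d) + 1) (by have := neg_pos.2 hneg; positivity)
    have h3 : (|f (ones L)| / (-f d)) * f d = -|f (ones L)| := by
      have := hneg.ne
      field_simp
    have h4 := neg_abs_le (f (ones L))
    have h5 := le_abs_self (f (ones L))
    nlinarith
  have hpos1 : 0 < f (ones L) := by
    have h1 := hsz _ ones_mem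
    have h2 := hft z ⟨hzX, le_rfl⟩
    linarith
  have hfz : f z ≤ c := by
    by_contra! h
    have := hsz (((f z - c) / f (ones L)) • ones L)
      (smul_pos_mem ones_mem (div_pos (by linarith) hpos1))
    rw [map_smul, smul_eq_mul, div_mul_cancel₀ _ hpos1.ne'] at this
    linarith
  set e : Fin L → Bundle L := fun l => EuclideanSpace.single l (1 : ℝ)
  have hexp : ∀ x : Bundle L, f x = ∑ l, x l * f (e l) := by
    intro x
    have : x = ∑ l, x l • e l := by
      ext i
      simp [e, Finset.sum_apply, Pi.single_apply]
    conv_lhs => rw [this]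
    simp [map_sum]
  set p : Bundle L := WithLp.toLp 2 fun l => f (e l) / f (ones L)
  have hpf : ∀ x : Bundle L, inner ℝ p x = f x / f (ones L) := by
    intro x
    rw [inner_eq_sum, hexp x, Finset.sum_div]
    exact Finset.sum_congr rfl fun l _ => by simp only [p]; ring
  refine ⟨p, ⟨fun l => div_nonneg (hnn _ fun i => ?_) hpos1.le, ?_⟩, fun y hy hzy => ?_⟩
  · by_cases h : i = l <;> simp [e, h]
  · have := hpf (ones L)
    rw [inner_eq_sum, div_self hpos1.ne'] at this
    simpa using this
  · rw [hpf, hpf]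
    exact div_le_div_of_nonneg_right (hfz.trans (hft y ⟨hy, hzy⟩)) hpos1.le

/-- If good `l` were free, adding a unit of it would raise utility at no cost, and shrinking the
result slightly would give a better bundle cheaper than `z`. -/
lemma IsSupportingPrice.pos (hu : IsRegularUtility u) {p z : Bundle L}
    (h : IsSupportingPrice u p z) (hz : z ∈ positiveOrthant L) : p ∈ positiveOrthant L := by
  intro l
  refine lt_of_le_of_ne (h.1.1 l) fun hl => ?_
  have hzX := consumptionSet_of_pos hz
  have heX : EuclideanSpace.single l (1 : ℝ) ∈ consumptionSet L := fun i => by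
    by_cases h : i = l <;> simp [h]
  have hlt : u z < u (z + EuclideanSpace.single l (1 : ℝ)) := by
    refine hu.lt_of_weakLE _ (add_mem hzX heX) _ hzX (fun i => ?_) fun heq => ?_
    · exact le_add_of_nonneg_right (heX i)
    · have := congrArg (fun x : Bundle L => x l) heq
      simp at this
  obtain ⟨s, hs0, hs1, hs⟩ := hu.exists_smul_lt (add_mem hzX heX) hlt
  have h1 := h.2 _ (smul_mem (add_mem hzX heX) hs0.le) hs.le
  have h2 : inner ℝ p (EuclideanSpace.single l (1 : ℝ)) = 0 := by
    rw [inner_eq_sum]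
    refine Finset.sum_eq_zero fun i _ => ?_
    by_cases hi : i = l
    · subst hi; simp [← hl]
    · simp [hi]
  rw [inner_smul_right, inner_add_right, h2] at h1
  nlinarith [inner_pos_of_priceSimplex h.1 hz]

lemma isSupportingPrice_of_tendsto [Nonempty (Fin L)] (hu : IsRegularUtility u) {p z : ℕ → Bundle L}
    {q y : Bundle L} (h : ∀ n, IsSupportingPrice u (p n) (z n)) (hz : ∀ n, z n ∈ consumptionSet L)
    (hp : Tendsto p atTop (𝓝 q)) (hzy : Tendsto z atTop (𝓝 y)) : IsSupportingPrice u q y := by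
  have hy : y ∈ consumptionSet L := isClosed_consumptionSet.mem_of_tendsto hzy (.of_forall hz)
  refine ⟨isCompact_priceSimplex.isClosed.mem_of_tendsto hp (.of_forall fun n => (h n).1),
    fun w hw hyw => ?_⟩
  have huz : Tendsto (fun n => u (z n)) atTop (𝓝 (u y)) :=
    (hu.continuousOn y hy).tendsto.comp (tendsto_nhdsWithin_iff.2 ⟨hzy, .of_forall hz⟩)
  -- The perturbation makes the utility comparison with `y` strict, so that it holds against `z n`
  -- for large `n`; letting `d` tend to zero removes it.
  have key : ∀ d : ℝ, 0 < d → inner ℝ q y ≤ inner ℝ q (w + d • ones L) := by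
    intro d hd
    have hwd : w + d • ones L ∈ consumptionSet L :=
      add_mem hw (smul_mem (consumptionSet_of_pos ones_mem) hd.le)
    have hlt : u y < u (w + d • ones L) :=
      hyw.trans_lt (hu.lt_of_forall_lt hw fun l => by simpa using hd)
    refine le_of_tendsto_of_tendsto (hp.inner hzy) (hp.inner tendsto_const_nhds) ?_
    filter_upwards [huz.eventually (gt_mem_nhds hlt)] with n hn
    exact (h n).2 _ hwd hn.le
  have hlim : Tendsto (fun d : ℝ => inner ℝ q (w + d • ones L)) (𝓝[>] 0) (𝓝 (inner ℝ q w)) := by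
    have : Continuous fun d : ℝ => inner ℝ q (w + d • ones L) := by fun_prop
    have h0 := this.tendsto 0
    simp only [zero_smul, add_zero] at h0
    exact h0.mono_left nhdsWithin_le_nhds
  exact ge_of_tendsto hlim (by filter_upwards [self_mem_nhdsWithin] with d hd using key d hd)

/-! ### Continuity of demand -/

lemma isCompact_budget {q : Bundle L} (hq : q ∈ positiveOrthant L) : IsCompact (budget q) := by
  have hcl : IsClosed (budget q) :=
    isClosed_consumptionSet.inter
      (isClosed_le (f := fun x => inner ℝ q x) (by fun_prop) continuous_const)
  refine Metric.isCompact_of_isClosed_isBounded hcl ?_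
  refine (Metric.isBounded_closedBall (x := (0 : Bundle L)) (r := ∑ l, 1 / q l)).subset
    fun x hx => ?_
  rw [mem_closedBall_zero_iff]
  have hxl : ∀ l, x l ≤ 1 / q l := fun l => by
    rw [le_div_iff₀ (hq l), mul_comm]
    refine le_trans ?_ hx.2
    rw [inner_eq_sum]
    exact Finset.single_le_sum (f := fun l => q l * x l)
      (fun i _ => mul_nonneg (hq i).le (hx.1 i)) (Finset.mem_univ l)
  have hexp : x = ∑ l, x l • EuclideanSpace.single l (1 : ℝ) := by
    ext i
    simp [Finset.sum_apply, Pi.single_apply]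
  rw [hexp]
  refine (norm_sum_le _ _).trans (Finset.sum_le_sum fun l _ => ?_)
  rw [norm_smul, PiLp.norm_single, norm_one, mul_one, Real.norm_of_nonneg (hx.1 l)]
  exact hxl l

/-- Otherwise the midpoint is strictly better than `z` and no dearer, and shrinking it slightly
contradicts support. -/
lemma IsSupportingPrice.eq_of_inner_le (hu : IsRegularUtility u) {p z w : Bundle L}
    (h : IsSupportingPrice u p z) (hz : z ∈ positiveOrthant L) (hw : w ∈ consumptionSet L)
    (huw : u z ≤ u w) (hpw : inner ℝ p w ≤ inner ℝ p z) : w = z := by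
  by_contra hne
  have hzX := consumptionSet_of_pos hz
  have hlt := hu.lt_convex w hw z hzX huw hne (1 / 2) (by norm_num) (by norm_num)
  have hm : (1 / 2 : ℝ) • w + (1 - 1 / 2 : ℝ) • z ∈ consumptionSet L :=
    add_mem (smul_mem hw (by norm_num)) (smul_mem hzX (by norm_num))
  obtain ⟨s, hs0, hs1, hs⟩ := hu.exists_smul_lt hm hlt
  have h1 := h.2 _ (smul_mem hm hs0.le) hs.le
  rw [inner_smul_right, inner_add_right, inner_smul_right, inner_smul_right] at h1
  nlinarith [inner_pos_of_priceSimplex h.1 hz]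

/-- Demand at prices near a supporting price of `z`, with income scaled so that `z` is just
affordable, is near `z`. -/
theorem tendsto_demand {R : Bundle L → Bundle L → Prop} (hu : IsRegularUtility u)
    (hrep : ∀ x ∈ consumptionSet L, ∀ y ∈ consumptionSet L, R x y ↔ u y ≤ u x)
    {q z : Bundle L} (h : IsSupportingPrice u q z) (hz : z ∈ positiveOrthant L)
    {P X : ℕ → Bundle L} (hX : ∀ n, X n ∈ demand R (P n))
    (hP : Tendsto P atTop (𝓝 ((inner ℝ q z)⁻¹ • q))) : Tendsto X atTop (𝓝 z) := by
  have hq := h.pos hu hz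
  have hqz := inner_pos_of_priceSimplex h.1 hz
  have hzX := consumptionSet_of_pos hz
  set q' := (inner ℝ q z)⁻¹ • q with hq'
  have hq'pos : q' ∈ positiveOrthant L := smul_pos_mem hq (inv_pos.2 hqz)
  have hinner : ∀ y, inner ℝ q' y = inner ℝ q y / inner ℝ q z := fun y => by
    rw [hq', real_inner_smul_left]; field_simp
  -- Prices near `q'` eventually exceed half of it, so one compact budget set contains all late
  -- demands.
  have hhalf : (1 / 2 : ℝ) • q' ∈ positiveOrthant L := smul_pos_mem hq'pos (by norm_num)
  have hev : ∀ᶠ n in atTop, X n ∈ budget ((1 / 2 : ℝ) • q') := by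
    have : P ⁻¹' {w | w - (1 / 2 : ℝ) • q' ∈ positiveOrthant L} ∈ atTop := by
      refine hP ((isOpen_positiveOrthant.preimage (f := fun w => w - (1 / 2 : ℝ) • q')
        (by fun_prop)).mem_nhds ?_)
      intro l
      change 0 < q' l - 1 / 2 * q' l
      linarith [hq'pos l]
    filter_upwards [this] with n hn
    refine ⟨(hX n).1.1, le_trans ?_ (hX n).1.2⟩
    rw [inner_eq_sum, inner_eq_sum]
    refine Finset.sum_le_sum fun l _ => mul_le_mul_of_nonneg_right ?_ ((hX n).1.1 l)
    have h0 : 0 < P n l - ((1 / 2 : ℝ) • q') l := hn l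
    linarith
  -- By compactness it is enough to identify every cluster point `w` with `z`: it is affordable, and
  -- at least as good as every affordable bundle `s • z` with `s < 1`.
  refine tendsto_of_subseq_tendsto fun ns hns => ?_
  obtain ⟨w, -, φ, hφ, hw⟩ := (isCompact_budget hhalf).tendsto_subseq'
    (hns.eventually hev).frequently
  refine ⟨φ, ?_⟩
  have hsub : Tendsto (fun n => ns (φ n)) atTop atTop := hns.comp hφ.tendsto_atTop
  have hPs := hP.comp hsub
  have hwX : w ∈ consumptionSet L :=
    isClosed_consumptionSet.mem_of_tendsto hw (.of_forall fun n => (hX _).1.1)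
  have hw1 : inner ℝ q' w ≤ 1 :=
    le_of_tendsto (hPs.inner hw) (.of_forall fun n => (hX _).1.2)
  have huX : Tendsto (fun n => u (X (ns (φ n)))) atTop (𝓝 (u w)) :=
    (hu.continuousOn w hwX).tendsto.comp
      (tendsto_nhdsWithin_iff.2 ⟨hw, .of_forall fun n => (hX _).1.1⟩)
  have huz : u z ≤ u w := by
    by_contra! hlt
    obtain ⟨s, hs0, hs1, hs⟩ := hu.exists_smul_lt hzX hlt
    have hlim : Tendsto (fun n => inner ℝ (P (ns (φ n))) (s • z)) atTop (𝓝 (inner ℝ q' (s • z))) :=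
      hPs.inner tendsto_const_nhds
    have hlt1 : inner ℝ q' (s • z) < 1 := by
      rw [inner_smul_right, hinner, div_self hqz.ne']; linarith
    have : u (s • z) ≤ u w := by
      refine ge_of_tendsto huX ?_
      filter_upwards [hlim.eventually (gt_mem_nhds hlt1)] with n hn
      have hsz := smul_mem hzX hs0.le
      exact (hrep _ (hX _).1.1 _ hsz).1 ((hX _).2 _ ⟨hsz, hn.le⟩)
    exact this.not_gt hs
  have hwz : w = z := by
    refine h.eq_of_inner_le hu hz hwX huz ?_
    rw [hinner, div_le_one hqz] at hw1
    exact hw1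
  rw [← hwz]; exact hw

/-! ### From undercuttings to observations -/

/-- `z'` is strictly cheaper than `z` at some price supporting the upper contour set of `z`. -/
def Undercut (u : Bundle L → ℝ) (z z' : Bundle L) : Prop :=
  z ∈ positiveOrthant L ∧ ∃ q, IsSupportingPrice u q z ∧ inner ℝ q z' < inner ℝ q z

/-- A chain of `k` strict comparisons between observations, starting within `δ` of `z` and ending
weakly above `b`. -/
def HasChainNear (p x : ℕ → Bundle L) (b z : Bundle L) (k : ℕ) : Prop :=
  ∀ δ > 0, ∃ i : ℕ → ℕ, ‖x (i 0) - z‖ < δ ∧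
    (∀ j < k, inner ℝ (p (i j)) (x (i (j + 1))) < inner ℝ (p (i j)) (x (i j))) ∧
    WeakLE b (x (i k))

section Observations

variable {R : Bundle L → Bundle L → Prop} {p x : ℕ → Bundle L}

lemma exists_seq_observation (hu : IsRegularUtility u)
    (hrep : ∀ x ∈ consumptionSet L, ∀ y ∈ consumptionSet L, R x y ↔ u y ≤ u x)
    (hdense : positiveOrthant L ⊆ closure (Set.range p)) (hx : ∀ k, x k ∈ demand R (p k))
    {q z : Bundle L} (h : IsSupportingPrice u q z) (hz : z ∈ positiveOrthant L) :
    ∃ k : ℕ → ℕ, Tendsto (fun n => p (k n)) atTop (𝓝 ((inner ℝ q z)⁻¹ • q)) ∧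
      Tendsto (fun n => x (k n)) atTop (𝓝 z) := by
  have hmem := hdense (smul_pos_mem (h.pos hu hz) (inv_pos.2 (inner_pos_of_priceSimplex h.1 hz)))
  obtain ⟨P, hP, hlim⟩ := mem_closure_iff_seq_limit.1 hmem
  choose k hk using hP
  obtain rfl : (fun n => p (k n)) = P := funext hk
  exact ⟨k, hlim, tendsto_demand hu hrep h hz (fun n => hx (k n)) hlim⟩

/-- The strict cost inequality is an open condition on the price and both bundles. It survives when
`q` (rescaled), `z` and `z'` are replaced by a close observation and the start of a close chain. -/
lemma HasChainNear.cons (hu : IsRegularUtility u)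
    (hrep : ∀ x ∈ consumptionSet L, ∀ y ∈ consumptionSet L, R x y ↔ u y ≤ u x)
    (hdense : positiveOrthant L ⊆ closure (Set.range p)) (hx : ∀ k, x k ∈ demand R (p k))
    {b z z' : Bundle L} {k : ℕ} (hstep : Undercut u z z') (h : HasChainNear p x b z' k) :
    HasChainNear p x b z (k + 1) := by
  intro δ hδ
  obtain ⟨hz, q, hq, hlt⟩ := hstep
  obtain ⟨m, hm1, hm2⟩ := exists_seq_observation hu hrep hdense hx hq hz
  choose i hi using fun n : ℕ => h (1 / ((n : ℝ) + 1)) (by positivity)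
  have hi0 : Tendsto (fun n => x (i n 0)) atTop (𝓝 z') := by
    rw [tendsto_iff_norm_sub_tendsto_zero]
    exact squeeze_zero (fun n => norm_nonneg _) (fun n => (hi n).1.le)
      tendsto_one_div_add_atTop_nhds_zero_nat
  have hlt' : inner ℝ ((inner ℝ q z)⁻¹ • q) z' < inner ℝ ((inner ℝ q z)⁻¹ • q) z := by
    rw [real_inner_smul_left, real_inner_smul_left]
    exact mul_lt_mul_of_pos_left hlt (inv_pos.2 (inner_pos_of_priceSimplex hq.1 hz))
  have hev1 := (hm1.inner hi0).eventually_lt (hm1.inner hm2) hlt'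
  have hev2 := (tendsto_iff_norm_sub_tendsto_zero.1 hm2).eventually (gt_mem_nhds hδ)
  obtain ⟨n, hn1, hn2⟩ := (hev1.and hev2).exists
  obtain ⟨-, hin1, hin2⟩ := hi n
  generalize i n = i' at hn1 hin1 hin2
  obtain ⟨g, hg0, hg⟩ : ∃ g : ℕ → ℕ, g 0 = m n ∧ ∀ j, g (j + 1) = i' j :=
    ⟨fun j => Nat.casesOn j (m n) i', rfl, fun _ => rfl⟩
  refine ⟨g, by rwa [hg0], fun j hj => ?_, by rwa [hg]⟩
  rcases j with _ | j
  · rw [hg, hg0]; exact hn1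
  · rw [hg, hg]; exact hin1 j (by omega)

lemma hasChainNear_of_forall_lt [Nonempty (Fin L)] (hu : IsRegularUtility u)
    (hrep : ∀ x ∈ consumptionSet L, ∀ y ∈ consumptionSet L, R x y ↔ u y ≤ u x)
    (hdense : positiveOrthant L ⊆ closure (Set.range p)) (hx : ∀ k, x k ∈ demand R (p k))
    {b z : Bundle L} (hz : z ∈ positiveOrthant L) (hbz : ∀ l, b l < z l) :
    HasChainNear p x b z 0 := by
  intro δ hδ
  obtain ⟨q, hq⟩ := hu.exists_isSupportingPrice hz
  obtain ⟨m, -, hm⟩ := exists_seq_observation hu hrep hdense hx hq hz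
  have hev1 := (tendsto_iff_norm_sub_tendsto_zero.1 hm).eventually (gt_mem_nhds hδ)
  have hev2 := hm ((isOpen_positiveOrthant.preimage (f := fun w => w - b)
        (by fun_prop)).mem_nhds (show z - b ∈ positiveOrthant L from fun l => sub_pos.2 (hbz l)))
  obtain ⟨n, hn1, hn2⟩ := (hev1.and hev2).exists
  refine ⟨fun _ => m n, hn1, fun j hj => absurd hj (Nat.not_lt_zero j), fun l => ?_⟩
  have : 0 < x (m n) l - b l := hn2 l
  linarith

lemma exists_hasChainNear [Nonempty (Fin L)] (hu : IsRegularUtility u)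
    (hrep : ∀ x ∈ consumptionSet L, ∀ y ∈ consumptionSet L, R x y ↔ u y ≤ u x)
    (hdense : positiveOrthant L ⊆ closure (Set.range p)) (hx : ∀ k, x k ∈ demand R (p k))
    {b z z' : Bundle L} (hz' : z' ∈ positiveOrthant L) (hbz : ∀ l, b l < z' l)
    (h : Relation.ReflTransGen (Undercut u) z z') : ∃ k, HasChainNear p x b z k := by
  induction h using Relation.ReflTransGen.head_induction_on with
  | refl => exact ⟨0, hasChainNear_of_forall_lt hu hrep hdense hx hz' hbz⟩
  | head hstep _ ih =>
    obtain ⟨k, hk⟩ := ih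
    exact ⟨k + 1, hk.cons hu hrep hdense hx hstep⟩

/-- A nontrivial chain of undercuttings yields a revealed preference between nearby bundles. -/
lemma exists_strictlyRevealedPreferred [Nonempty (Fin L)] (hu : IsRegularUtility u)
    (hrep : ∀ x ∈ consumptionSet L, ∀ y ∈ consumptionSet L, R x y ↔ u y ≤ u x)
    (hdense : positiveOrthant L ⊆ closure (Set.range p)) (hx : ∀ k, x k ∈ demand R (p k))
    {a b z z' : Bundle L} (hne : z ≠ z') (hza : ∀ l, z l < a l) (hz' : z' ∈ positiveOrthant L)
    (hbz : ∀ l, b l < z' l) (h : Relation.ReflTransGen (Undercut u) z z') :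
    ∃ n, StrictlyRevealedPreferred p x n a b := by
  obtain rfl | ⟨c, hzc, hcz'⟩ := Relation.ReflTransGen.cases_head h
  · exact absurd rfl hne
  obtain ⟨k, hk⟩ := exists_hasChainNear hu hrep hdense hx hz' hbz hcz'
  have hk := hk.cons hu hrep hdense hx hzc
  obtain ⟨l₀, hl₀⟩ := Finite.exists_min fun l => a l - z l
  obtain ⟨i, hi0, hij, hik⟩ := hk _ (sub_pos.2 (hza l₀))
  -- A chain of `k + 1` comparisons involves the `k + 2` observations `i 0, …, i (k + 1)`, all of
  -- which must lie below the bound.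
  refine ⟨(Finset.range (k + 2)).sup i + 1, k + 1, i, by omega, fun j hj => ?_, fun l => ?_,
    hij, hik⟩
  · exact Nat.lt_succ_of_le (Finset.le_sup (f := i) (Finset.mem_range.2 (by omega)))
  · have h1 : ‖(x (i 0) - z) l‖ ≤ ‖x (i 0) - z‖ := PiLp.norm_apply_le _ _
    have h2 : (x (i 0) - z) l = x (i 0) l - z l := rfl
    rw [h2, Real.norm_eq_abs] at h1
    have := le_abs_self (x (i 0) l - z l)
    have := hl₀ l
    linarith

/-- Revealed preference is sound. -/
lemma StrictlyRevealedPreferred.lt [Nonempty (Fin L)] (hu : IsRegularUtility u)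
    (hrep : ∀ x ∈ consumptionSet L, ∀ y ∈ consumptionSet L, R x y ↔ u y ≤ u x)
    (hpos : ∀ k, p k ∈ positiveOrthant L) (hx : ∀ k, x k ∈ demand R (p k))
    {a b : Bundle L} {n : ℕ} (ha : a ∈ consumptionSet L) (hb : b ∈ consumptionSet L)
    (h : StrictlyRevealedPreferred p x n a b) : u b < u a := by
  obtain ⟨k, i, hk, -, h0, hij, hbk⟩ := h
  have hX : ∀ k, x k ∈ consumptionSet L := fun k => (hx k).1.1
  have hstep : ∀ j < k, u (x (i (j + 1))) < u (x (i j)) := by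
    intro j hj
    set P := p (i j)
    have hlt : inner ℝ P (x (i (j + 1))) < 1 := (hij j hj).trans_le (hx (i j)).1.2
    have hP1 : 0 < inner ℝ P (ones L) := inner_pos_of_pos (hpos _) ones_mem
    -- The unspent income buys `d` more units of every good.
    set d := (1 - inner ℝ P (x (i (j + 1)))) / inner ℝ P (ones L)
    have hd : 0 < d := div_pos (by linarith) hP1
    have hmem : x (i (j + 1)) + d • ones L ∈ consumptionSet L :=
      add_mem (hX _) (smul_mem (consumptionSet_of_pos ones_mem) hd.le)
    have hbud : x (i (j + 1)) + d • ones L ∈ budget P := by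
      refine ⟨hmem, ?_⟩
      rw [inner_add_right, inner_smul_right, div_mul_cancel₀ _ hP1.ne']
      linarith
    exact (hu.lt_of_forall_lt (hX _) fun l => by simpa using hd).trans_le
      ((hrep _ (hX _) _ hmem).1 ((hx (i j)).2 _ hbud))
  have hchain : ∀ j, j + 1 ≤ k → u (x (i (j + 1))) < u (x (i 0)) := by
    intro j
    induction j with
    | zero => exact fun hj => hstep 0 hj
    | succ j ih => exact fun hj => (hstep (j + 1) hj).trans (ih (by omega))
  obtain ⟨m, rfl⟩ : ∃ m, k = m + 1 := ⟨k - 1, by omega⟩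
  exact (hu.mono (hX _) hb hbk).trans_lt ((hchain m le_rfl).trans_le (hu.mono ha (hX _) h0))

end Observations

/-! ### Following a curve by undercuttings -/

/-- Along a subsequence the `p n` converge to a price `q` supporting at `w`, so `‖p n - q‖ * ‖y n -
w‖ = o(h n)`. The two bounds serve the approaches to a point of the curve from its left and from its
right. -/
lemma exists_isSupportingPrice_close [Nonempty (Fin L)] (hu : IsRegularUtility u)
    {p y : ℕ → Bundle L} {h : ℕ → ℝ} {w : Bundle L} {C κ : ℝ} (hκ : 0 < κ)
    (hp : ∀ n, IsSupportingPrice u (p n) (y n)) (hy : ∀ n, y n ∈ positiveOrthant L)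
    (hw : w ∈ positiveOrthant L) (hh : ∀ n, 0 < h n) (hlim : Tendsto h atTop (𝓝 0))
    (hC : ∀ n, ‖y n - w‖ ≤ C * h n) :
    ∃ q, IsSupportingPrice u q w ∧ ∃ n, |inner ℝ (p n - q) (y n - w)| < κ * h n * inner ℝ q (y n) ∧
      |inner ℝ (p n - q) (y n - w)| < κ * h n * inner ℝ (p n) w := by
  have hyw : Tendsto y atTop (𝓝 w) := by
    rw [tendsto_iff_norm_sub_tendsto_zero]
    refine squeeze_zero (fun n => norm_nonneg _) hC ?_
    simpa using hlim.const_mul C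
  obtain ⟨q, -, φ, hφ, hq⟩ := isCompact_priceSimplex.tendsto_subseq fun n => (hp n).1
  have hyφ := hyw.comp hφ.tendsto_atTop
  have hqw := isSupportingPrice_of_tendsto hu (fun n => hp (φ n))
    (fun n => consumptionSet_of_pos (hy (φ n))) hq hyφ
  have hqpos := inner_pos_of_priceSimplex hqw.1 hw
  refine ⟨q, hqw, ?_⟩
  have h0 : Tendsto (fun n => ‖p (φ n) - q‖ * C) atTop (𝓝 0) := by
    simpa using (tendsto_iff_norm_sub_tendsto_zero.1 hq).mul_const C
  have hlt : inner ℝ q w / 2 < inner ℝ q w := by linarith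
  have e1 := h0.eventually (gt_mem_nhds (show 0 < κ * (inner ℝ q w / 2) by positivity))
  have e2 := ((tendsto_const_nhds (x := q)).inner hyφ).eventually (lt_mem_nhds hlt)
  have e3 := (hq.inner (tendsto_const_nhds (x := w))).eventually (lt_mem_nhds hlt)
  obtain ⟨n, h1, h2, h3⟩ := (e1.and (e2.and e3)).exists
  simp only [Function.comp_apply] at h2 h3
  have hb : |inner ℝ (p (φ n) - q) (y (φ n) - w)| < κ * h (φ n) * (inner ℝ q w / 2) := by
    calc _ ≤ ‖p (φ n) - q‖ * ‖y (φ n) - w‖ := abs_real_inner_le_norm _ _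
      _ ≤ ‖p (φ n) - q‖ * (C * h (φ n)) := mul_le_mul_of_nonneg_left (hC _) (norm_nonneg _)
      _ = ‖p (φ n) - q‖ * C * h (φ n) := by ring
      _ < κ * (inner ℝ q w / 2) * h (φ n) := mul_lt_mul_of_pos_right h1 (hh _)
      _ = _ := by ring
  have hκh : 0 < κ * h (φ n) := mul_pos hκ (hh _)
  exact ⟨φ n, hb.trans (mul_lt_mul_of_pos_left h2 hκh), hb.trans (mul_lt_mul_of_pos_left h3 hκh)⟩

/-- A curve along which utility falls at a definite rate, and which moves at bounded speed except
where it falls in every coordinate, can be followed by a finite chain of undercuttings. -/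
theorem reflTransGen_undercut_of_curve [Nonempty (Fin L)] (hu : IsRegularUtility u)
    {z : ℝ → Bundle L} (hz : ∀ t, 0 ≤ t → t ≤ 1 → z t ∈ positiveOrthant L)
    {κ h₀ C : ℝ} (hκ : 0 < κ) (hh₀ : 0 < h₀) (hκh : κ * h₀ ≤ 1)
    (hdrop : ∀ s t, 0 ≤ s → s < t → t ≤ 1 → t - s < h₀ → u (z t) ≤ u ((1 - κ * (t - s)) • z s))
    (hC : ∀ s t, 0 ≤ s → s < t → t ≤ 1 → ‖z t - z s‖ ≤ C * (t - s) ∨ ∀ l, z t l < z s l) :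
    Relation.ReflTransGen (Undercut u) (z 0) (z 1) := by
  have hsm : ∀ s t, 0 ≤ s → s < t → t ≤ 1 → t - s < h₀ →
      (1 - κ * (t - s)) • z s ∈ consumptionSet L := fun s t hs hst ht hd =>
    smul_mem (consumptionSet_of_pos (hz s hs (hst.le.trans ht))) (by nlinarith)
  have hdown : ∀ s t, 0 ≤ s → s < t → t ≤ 1 → (∀ l, z t l < z s l) → Undercut u (z s) (z t) := by
    intro s t hs hst ht hl
    have hzs := hz s hs (hst.le.trans ht)
    obtain ⟨q, hq⟩ := hu.exists_isSupportingPrice hzs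
    refine ⟨hzs, q, hq, ?_⟩
    have := inner_pos_of_priceSimplex hq.1 (z := z s - z t) fun l => sub_pos.2 (hl l)
    rw [inner_sub_right] at this
    linarith
  -- Where undercutting fails, the fall in every coordinate is excluded, so the speed bound is
  -- available in the arguments by contradiction.
  have hC' : ∀ s t, 0 ≤ s → s < t → t ≤ 1 → ¬ Undercut u (z s) (z t) →
      ‖z t - z s‖ ≤ C * (t - s) := fun s t hs hst ht hnot =>
    (hC s t hs hst ht).resolve_right fun hl => hnot (hdown s t hs hst ht hl)
  have hseq : ∀ d : ℝ, Tendsto (fun n : ℕ => d * (1 / ((n : ℝ) + 1))) atTop (𝓝 0) := fun d => by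
    simpa only [mul_zero] using tendsto_one_div_add_atTop_nhds_zero_nat.const_mul d
  have hseq_le : ∀ d : ℝ, 0 ≤ d → ∀ n : ℕ, d * (1 / ((n : ℝ) + 1)) ≤ d := fun d hd n =>
    mul_le_of_le_one_right hd
      (by rw [div_le_one (by positivity)]; linarith [n.cast_nonneg (α := ℝ)])
  -- The utility drop is priced at the later bundles `z (t + h n)`, and the saving is transferred to
  -- their limit price `q`, which supports at `z t`.
  have hright : ∀ t, 0 ≤ t → t < 1 → ∃ t', t < t' ∧ t' ≤ 1 ∧ Undercut u (z t) (z t') := by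
    intro t ht0 ht1
    by_contra! hno
    set d := min h₀ (1 - t) / 2
    have hd0 : 0 < d := half_pos (lt_min hh₀ (by linarith))
    have hd1 : d < h₀ := by linarith [min_le_left h₀ (1 - t), show d = min h₀ (1 - t) / 2 from rfl]
    have hd2 : d < 1 - t := by
      linarith [min_le_right h₀ (1 - t), show d = min h₀ (1 - t) / 2 from rfl]
    set h : ℕ → ℝ := fun n => d * (1 / ((n : ℝ) + 1))
    have hh : ∀ n, 0 < h n := fun n => by positivity
    have hhd : ∀ n, h n ≤ d := hseq_le d hd0.le
    have hlim : Tendsto h atTop (𝓝 0) := hseq d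
    have hlt : ∀ n, t < t + h n := fun n => by linarith [hh n]
    have hle : ∀ n, t + h n ≤ 1 := fun n => by linarith [hhd n]
    have hyp : ∀ n, z (t + h n) ∈ positiveOrthant L := fun n => hz _ (by linarith [hh n]) (hle n)
    choose p hp using fun n => hu.exists_isSupportingPrice (hyp n)
    obtain ⟨q, hq, n, -, hn⟩ := exists_isSupportingPrice_close hu hκ hp hyp (hz t ht0 ht1.le) hh hlim
      (C := C) fun n => by
        simpa using hC' t (t + h n) ht0 (hlt n) (hle n) (hno _ (hlt n) (hle n))
    refine hno _ (hlt n) (hle n) ⟨hz t ht0 ht1.le, q, hq, ?_⟩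
    have hsub : t + h n - t < h₀ := by linarith [hhd n]
    have h1 := (hp n).2 _ (hsm t _ ht0 (hlt n) (hle n) hsub) (hdrop t _ ht0 (hlt n) (hle n) hsub)
    rw [inner_smul_right, add_sub_cancel_left] at h1
    simp only [inner_sub_left, inner_sub_right] at hn
    have h2 := (abs_lt.1 hn).1
    linarith
  -- Here the drop is priced at the limit price `q` of `z t` and transferred to the prices `p n` of
  -- the earlier bundles. A whole left neighbourhood is needed, because it is not known which points
  -- near a supremum are reachable.
  have hleft : ∀ t, 0 < t → t ≤ 1 → ∃ δ > 0, ∀ s, 0 ≤ s → t - δ < s → s < t →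
      Undercut u (z s) (z t) := by
    intro t ht0 ht1
    by_contra! hno
    choose s hs using fun n : ℕ => hno (h₀ * (1 / ((n : ℝ) + 1))) (by positivity)
    set h : ℕ → ℝ := fun n => t - s n
    have hh : ∀ n, 0 < h n := fun n => sub_pos.2 (hs n).2.2.1
    have hhd : ∀ n, h n < h₀ := fun n => by
      have h1 := hseq_le h₀ hh₀.le n
      have := (hs n).2.1
      simp only [h]; linarith
    have hlim : Tendsto h atTop (𝓝 0) := by
      refine squeeze_zero (fun n => (hh n).le) (fun n => ?_) (hseq h₀)
      have := (hs n).2.1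
      simp only [h]; linarith
    have hyp : ∀ n, z (s n) ∈ positiveOrthant L := fun n =>
      hz _ (hs n).1 ((hs n).2.2.1.le.trans ht1)
    choose p hp using fun n => hu.exists_isSupportingPrice (hyp n)
    obtain ⟨q, hq, n, hn, -⟩ := exists_isSupportingPrice_close hu hκ hp hyp (hz t ht0.le ht1) hh hlim
      (C := C) fun n => by
        rw [norm_sub_rev]
        exact hC' (s n) t (hs n).1 (hs n).2.2.1 ht1 (hs n).2.2.2
    refine (hs n).2.2.2 ⟨hyp n, p n, hp n, ?_⟩
    have h1 := hq.2 _ (hsm _ t (hs n).1 (hs n).2.2.1 ht1 (hhd n))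
      (hdrop _ t (hs n).1 (hs n).2.2.1 ht1 (hhd n))
    rw [inner_smul_right] at h1
    simp only [inner_sub_left, inner_sub_right] at hn
    have h2 := (abs_lt.1 hn).1
    simp only [h] at h2
    linarith
  -- The supremum of the reachable times is reachable by `hleft`, and equals `1` by `hright`.
  set S : Set ℝ := {t | 0 ≤ t ∧ t ≤ 1 ∧ Relation.ReflTransGen (Undercut u) (z 0) (z t)}
  have h0S : (0 : ℝ) ∈ S := ⟨le_rfl, zero_le_one, .refl⟩
  have hbdd : BddAbove S := ⟨1, fun t ht => ht.2.1⟩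
  have hs0 : 0 ≤ sSup S := le_csSup hbdd h0S
  have hs1 : sSup S ≤ 1 := csSup_le ⟨0, h0S⟩ fun t ht => ht.2.1
  have hsS : sSup S ∈ S := by
    rcases hs0.eq_or_lt with h | h
    · rw [← h]; exact h0S
    · obtain ⟨δ, hδ, hstep⟩ := hleft _ h hs1
      obtain ⟨t, ht, hlt⟩ := exists_lt_of_lt_csSup ⟨0, h0S⟩ (sub_lt_self (sSup S) hδ)
      rcases (le_csSup hbdd ht).eq_or_lt with h' | h'
      · rw [← h']; exact ht
      · exact ⟨hs0, hs1, ht.2.2.tail (hstep t ht.1 hlt h')⟩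
  rcases hs1.eq_or_lt with h | h
  · rw [h] at hsS; exact hsS.2.2
  · obtain ⟨t, ht, ht1, hstep⟩ := hright _ hs0 h
    exact absurd (le_csSup hbdd ⟨hs0.trans ht.le, ht1, hsS.2.2.tail hstep⟩) ht.not_ge

/-! ### Constructing the curve -/

lemma exists_apply_le_of_le [Nonempty (Fin L)] (hu : IsRegularUtility u) {x y : Bundle L}
    (hy : y ∈ consumptionSet L) (h : u x ≤ u y) : ∃ l, x l ≤ y l := by
  by_contra! hlt
  exact (hu.lt_of_forall_lt hy hlt).not_ge h

/-- A bundle at least as good as `v • ones L` has some coordinate at least `v`, and that coordinate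
alone gives the distance. -/
lemma le_infDist_diag [Nonempty (Fin L)] {R : Bundle L → Bundle L → Prop}
    (hu : IsRegularUtility u)
    (hrep : ∀ x ∈ consumptionSet L, ∀ y ∈ consumptionSet L, R x y ↔ u y ≤ u x)
    {v v' : ℝ} (hv : 0 ≤ v) :
    v - v' ≤ Metric.infDist (v' • ones L) (upperContour R (v • ones L)) := by
  have hvX : v • ones L ∈ consumptionSet L := smul_mem (consumptionSet_of_pos ones_mem) hv
  refine (Metric.le_infDist (⟨v • ones L, hvX, (hrep _ hvX _ hvX).2 le_rfl⟩ :
    (upperContour R (v • ones L)).Nonempty)).2 fun {w} hw => ?_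
  obtain ⟨l, hl⟩ := exists_apply_le_of_le hu hw.1 ((hrep _ hw.1 _ hvX).1 hw.2)
  rw [dist_comm, dist_eq_norm]
  have h1 : ‖(w - v' • ones L) l‖ ≤ ‖w - v' • ones L‖ := PiLp.norm_apply_le _ _
  have h2 := le_abs_self ((w - v' • ones L) l)
  rw [Real.norm_eq_abs] at h1
  have h3 : (w - v' • ones L) l = w l - v' := by simp
  have h4 : (v • ones L) l = v := by simp
  linarith

/-- Since neither bundle lies strictly below the other in all coordinates, comparing one coordinate
in each direction bounds `|ρ - σ|` by a multiple of `h`. -/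
lemma norm_smul_sub_smul_le {x y d : Bundle L} {σ ρ h m M A N : ℝ} (hm : 0 < m) (hM : 0 ≤ M)
    (hh : 0 < h) (hy : y = x + h • d) (hd : ∀ l, |d l| ≤ M) (hmy : ∀ l, m ≤ y l) (hN : ‖y‖ ≤ N)
    (hσ : 0 ≤ σ) (hσA : σ ≤ A) (h1 : ∃ l, (σ • x) l ≤ (ρ • y) l)
    (h2 : ∃ l, (ρ • y) l ≤ (σ • x) l) :
    ‖ρ • y - σ • x‖ ≤ (A * M / m * N + A * ‖d‖) * h := by
  have hnn : 0 ≤ σ * (M * h) := by positivity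
  have hyl : ∀ l, y l = x l + h * d l := fun l => by simp [hy]
  have hlow : (σ - ρ) * m ≤ σ * (M * h) := by
    obtain ⟨l, hl⟩ := h1
    have hl : σ * x l ≤ ρ * y l := hl
    rcases le_total σ ρ with hρ | hρ
    · nlinarith
    · have e1 : (σ - ρ) * m ≤ (σ - ρ) * y l := mul_le_mul_of_nonneg_left (hmy l) (sub_nonneg.2 hρ)
      have e2 : h * d l ≤ M * h := by nlinarith [(abs_le.1 (hd l)).2]
      have e3 := mul_le_mul_of_nonneg_left e2 hσ
      have e4 : σ * y l = σ * x l + σ * (h * d l) := by rw [hyl]; ring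
      linarith
  have hupp : (ρ - σ) * m ≤ σ * (M * h) := by
    obtain ⟨l, hl⟩ := h2
    have hl : ρ * y l ≤ σ * x l := hl
    rcases le_total ρ σ with hρ | hρ
    · nlinarith
    · have e1 : (ρ - σ) * m ≤ (ρ - σ) * y l := mul_le_mul_of_nonneg_left (hmy l) (sub_nonneg.2 hρ)
      have e2 : -(M * h) ≤ h * d l := by nlinarith [(abs_le.1 (hd l)).1]
      have e3 := mul_le_mul_of_nonneg_left e2 hσ
      have e4 : σ * y l = σ * x l + σ * (h * d l) := by rw [hyl]; ring
      linarith
  have habs : |ρ - σ| ≤ A * M / m * h := by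
    have e1 : σ * (M * h) ≤ A * (M * h) := mul_le_mul_of_nonneg_right hσA (by positivity)
    have e2 : A * M / m * h = A * (M * h) / m := by ring
    rw [e2, le_div_iff₀ hm]
    rcases abs_cases (ρ - σ) with ⟨e, -⟩ | ⟨e, -⟩ <;> rw [e] <;> linarith
  have hdec : ρ • y - σ • x = (ρ - σ) • y + σ • (h • d) := by
    rw [hy]; module
  rw [hdec]
  refine (norm_add_le _ _).trans ?_
  rw [norm_smul, norm_smul, norm_smul, Real.norm_eq_abs, Real.norm_of_nonneg hσ,
    Real.norm_of_nonneg hh.le]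
  have e1 : |ρ - σ| * ‖y‖ ≤ A * M / m * h * N :=
    mul_le_mul habs hN (norm_nonneg _) ((abs_nonneg _).trans habs)
  have e2 : σ * (h * ‖d‖) ≤ A * (h * ‖d‖) := mul_le_mul_of_nonneg_right hσA (by positivity)
  linarith

theorem reflTransGen_undercut_of_lt [Nonempty (Fin L)] {R : Bundle L → Bundle L → Prop}
    (hu : IsRegularUtility u)
    (hrep : ∀ x ∈ consumptionSet L, ∀ y ∈ consumptionSet L, R x y ↔ u y ≤ u x)
    (hlip : LipschitzianPref R) {a b : Bundle L} (ha : a ∈ positiveOrthant L)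
    (hb : b ∈ positiveOrthant L) (hab : u b < u a) : Relation.ReflTransGen (Undercut u) a b := by
  have hX {x : Bundle L} (hx : x ∈ positiveOrthant L) := consumptionSet_of_pos hx
  have hdiagX {s : ℝ} (hs : 0 ≤ s) : s • ones L ∈ consumptionSet L := smul_mem (hX ones_mem) hs
  set α := u a
  set β := u b
  have hβ : 0 < β := by
    rw [← hu.diag 0 le_rfl]
    exact hu.lt_of_forall_lt (hdiagX le_rfl) fun l => by simpa using hb l
  have hα : 0 < α := hβ.trans hab
  obtain ⟨m, hm, hma, hmb⟩ : ∃ m : ℝ, 0 < m ∧ (∀ l, m ≤ a l) ∧ ∀ l, m ≤ b l := by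
    obtain ⟨i, hi⟩ := Finite.exists_min a
    obtain ⟨j, hj⟩ := Finite.exists_min b
    exact ⟨min (a i) (b j), lt_min (ha i) (hb j), fun l => (min_le_left _ _).trans (hi l),
      fun l => (min_le_right _ _).trans (hj l)⟩
  obtain ⟨M, hMa, hMb⟩ : ∃ M : ℝ, (∀ l, a l ≤ M) ∧ ∀ l, b l ≤ M := by
    obtain ⟨i, hi⟩ := Finite.exists_max a
    obtain ⟨j, hj⟩ := Finite.exists_max b
    exact ⟨max (a i) (b j), fun l => (hi l).trans (le_max_left _ _),
      fun l => (hj l).trans (le_max_right _ _)⟩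
  have hmM : m ≤ M := (hma (Classical.arbitrary _)).trans (hMa _)
  have hM : 0 < M := hm.trans_le hmM
  set c : ℝ → Bundle L := fun t => (1 - t) • a + t • b
  have hcl : ∀ t l, c t l = (1 - t) * a l + t * b l := fun t l => by simp [c]
  have hcm : ∀ t, 0 ≤ t → t ≤ 1 → ∀ l, m ≤ c t l := fun t h0 h1 l => by
    rw [hcl]; nlinarith [hma l, hmb l]
  have hcM : ∀ t, 0 ≤ t → t ≤ 1 → ∀ l, c t l ≤ M := fun t h0 h1 l => by
    rw [hcl]; nlinarith [hMa l, hMb l]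
  have hcpos : ∀ t, 0 ≤ t → t ≤ 1 → c t ∈ positiveOrthant L := fun t h0 h1 l =>
    hm.trans_le (hcm t h0 h1 l)
  -- Target utility at time `t`; the factor `f t` chosen below scales `c t` to this level.
  set v : ℝ → ℝ := fun t => (1 - t) * α + t * β
  have hvβ : ∀ t, t ≤ 1 → β ≤ v t := fun t h1 => by simp only [v]; nlinarith
  have hvα : ∀ t, 0 ≤ t → v t ≤ α := fun t h0 => by simp only [v]; nlinarith
  have hvsub : ∀ s t, v s - v t = (α - β) * (t - s) := fun s t => by simp only [v]; ring
  have hbound : ∀ s t w, 0 ≤ t → t ≤ 1 → 0 < s → 0 < w → u (s • c t) = w → s * m ≤ w ∧ w ≤ s * M := by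
    intro s t w h0 h1 hs hw hsw
    have hsX := smul_mem (hX (hcpos t h0 h1)) hs.le
    have hw' := hu.diag w hw.le
    constructor
    · obtain ⟨l, hl⟩ := exists_apply_le_of_le hu (hdiagX hw.le) (hsw.trans hw'.symm).le
      have h2 : s * c t l ≤ w := by simpa using hl
      nlinarith [hcm t h0 h1 l]
    · obtain ⟨l, hl⟩ := exists_apply_le_of_le hu hsX (hw'.trans hsw.symm).le
      have h2 : w ≤ s * c t l := by simpa using hl
      nlinarith [hcM t h0 h1 l]
  have hlevel : ∀ t, ∃ s : ℝ, 0 ≤ t → t ≤ 1 → 0 < s ∧ u (s • c t) = v t := by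
    intro t
    by_cases h : 0 ≤ t ∧ t ≤ 1
    · obtain ⟨s, hs⟩ := hu.exists_smul_eq (hcpos t h.1 h.2) (hβ.trans_le (hvβ t h.2))
      exact ⟨s, fun _ _ => hs⟩
    · exact ⟨0, fun h0 h1 => absurd ⟨h0, h1⟩ h⟩
  choose f hf using hlevel
  set z : ℝ → Bundle L := fun t => f t • c t
  have hzpos : ∀ t, 0 ≤ t → t ≤ 1 → z t ∈ positiveOrthant L := fun t h0 h1 =>
    smul_pos_mem (hcpos t h0 h1) (hf t h0 h1).1
  have hfα : ∀ t, 0 ≤ t → t ≤ 1 → f t ≤ α / m := fun t h0 h1 => by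
    rw [le_div_iff₀ hm]
    obtain ⟨hf0, hf1⟩ := hf t h0 h1
    exact (hbound _ _ _ h0 h1 hf0 (hβ.trans_le (hvβ t h1)) hf1).1.trans (hvα t h0)
  set N := ‖a‖ + ‖b‖
  have hcN : ∀ t, 0 ≤ t → t ≤ 1 → ‖c t‖ ≤ N := fun t h0 h1 => by
    refine (norm_add_le _ _).trans ?_
    rw [norm_smul, norm_smul, Real.norm_of_nonneg h0, Real.norm_of_nonneg (sub_nonneg.2 h1)]
    have h2 := norm_nonneg a
    have h3 := norm_nonneg b
    simp only [N]; nlinarith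
  have hN : 0 ≤ N := by positivity
  have hαm : 0 < α / m := div_pos hα hm
  have hzN : ∀ t, 0 ≤ t → t ≤ 1 → ‖z t‖ ≤ α / m * N := fun t h0 h1 => by
    rw [norm_smul, Real.norm_of_nonneg (hf t h0 h1).1.le]
    exact mul_le_mul (hfα t h0 h1) (hcN t h0 h1) (norm_nonneg _) hαm.le
  have hone : ∀ t, 0 ≤ t → t ≤ 1 → u (c t) = v t → z t = c t := fun t h0 h1 h => by
    obtain ⟨hf0, hf1⟩ := hf t h0 h1
    have h2 : u (f t • c t) = u ((1 : ℝ) • c t) := by rw [one_smul, hf1, h]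
    have : f t = 1 := le_antisymm
      (hu.le_of_smul_le_smul (hcpos t h0 h1) zero_le_one h2.le)
      (hu.le_of_smul_le_smul (hcpos t h0 h1) hf0.le h2.ge)
    simp [z, this]
  have hz0 : z 0 = a := by
    have hc0 : c 0 = a := by simp [c]
    rw [hone 0 le_rfl zero_le_one (by rw [hc0]; simp [v, α]), hc0]
  have hz1 : z 1 = b := by
    have hc1 : c 1 = b := by simp [c]
    rw [hone 1 zero_le_one le_rfl (by rw [hc1]; simp [v, β]), hc1]
  -- the Lipschitz hypothesis on a box containing all bundles that occur
  set lo := β / M * m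
  set hi := α / m * M
  have hlo : 0 < lo := by positivity
  have hhi : 0 < hi := by positivity
  set r := max hi (1 / lo)
  have hr : 0 < r := hhi.trans_le (le_max_left _ _)
  have hbox : ∀ x : Bundle L, (∀ l, lo ≤ x l ∧ x l ≤ hi) → x ∈ box L r := by
    intro x hx l
    refine ⟨le_trans ?_ (hx l).1,
      (hx l).2.trans ((le_max_left hi (1 / lo)).trans (by simp only [r]; linarith))⟩
    rw [div_le_comm₀ (by linarith) hlo]
    exact (le_max_right hi (1 / lo)).trans (by simp only [r]; linarith)
  have hboxdiag : ∀ t, 0 ≤ t → t ≤ 1 → v t • ones L ∈ box L r := by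
    refine fun t h0 h1 => hbox _ fun l => ?_
    have e : (v t • ones L) l = v t := by simp
    rw [e]
    constructor
    · refine le_trans ?_ (hvβ t h1)
      simp only [lo]
      rw [div_mul_eq_mul_div, div_le_iff₀ hM]
      exact mul_le_mul_of_nonneg_left hmM hβ.le
    · refine (hvα t h0).trans ?_
      simp only [hi]
      rw [div_mul_eq_mul_div, le_div_iff₀ hm]
      exact mul_le_mul_of_nonneg_left hmM hα.le
  obtain ⟨H, hH, ε, hε, hlipr⟩ := hlip r hr
  -- The summand `α - β` makes `κ ≤ 1 / 2`, and the factor `2` in `κ` makes `hκD` strict.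
  set D := H * (α / m * N) + (α - β)
  have hD : 0 < D := by have := sub_pos.2 hab; positivity
  set κ := (α - β) / (2 * D)
  have hκ : 0 < κ := div_pos (sub_pos.2 hab) (by linarith)
  have hκ1 : κ ≤ 1 / 2 := by
    simp only [κ]
    rw [div_le_div_iff₀ (by linarith) (by norm_num)]
    have : 0 ≤ H * (α / m * N) := by positivity
    simp only [D]; linarith
  have hκD : H * (κ * (α / m * N)) < α - β := by
    have h1 : κ * (2 * D) = α - β := div_mul_cancel₀ _ (by linarith)
    have h2 : H * (α / m * N) ≤ D := by simp only [D]; linarith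
    nlinarith
  have hones : 0 ≤ ‖ones L‖ := norm_nonneg _
  -- Keeps the diagonal bundles at levels `v s` and `v t` within `ε` of each other.
  set h₀ := min 1 (ε / ((α - β) * ‖ones L‖ + 1))
  have hden : 0 < (α - β) * ‖ones L‖ + 1 := by have := sub_pos.2 hab; positivity
  have hh₀ : 0 < h₀ := lt_min one_pos (by positivity)
  have hdrop : ∀ s t, 0 ≤ s → s < t → t ≤ 1 → t - s < h₀ →
      u (z t) ≤ u ((1 - κ * (t - s)) • z s) := by
    intro s t hs hst ht hd
    by_contra! hlt
    have hs1 := hst.le.trans ht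
    have ht0 := hs.trans hst.le
    have hd1 : t - s < 1 := hd.trans_le (min_le_left _ _)
    have hμ0 : 0 < 1 - κ * (t - s) := by nlinarith
    have hzs := hzpos s hs hs1
    have hvt : 0 < v t := hβ.trans_le (hvβ t ht)
    have hvs : 0 < v s := hβ.trans_le (hvβ s hs1)
    have huzt : u (z t) = v t := (hf t ht0 ht).2
    have huzs : u (z s) = v s := (hf s hs hs1).2
    have hvst := hvsub s t
    have hpos : 0 < (α - β) * (t - s) := mul_pos (sub_pos.2 hab) (sub_pos.2 hst)
    -- If the drop failed, a shrinking of `z s` by less than `κ * (t - s)` would already reach level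
    -- `v t`. That bundle is then too close to the upper contour set of level `v s`, compared with
    -- the indifferent diagonal bundle, which is at distance at least `(α - β) * (t - s)`.
    obtain ⟨μ, hμ, hμu⟩ := intermediate_value_Icc (by nlinarith : 1 - κ * (t - s) ≤ 1)
      ((hu.continuousOn_ray (hX hzs)).mono fun x hx => hμ0.le.trans hx.1)
      (show v t ∈ _ from ⟨by simpa [huzt] using hlt.le, by simp only [one_smul, huzs]; linarith⟩)
    simp only at hμu
    have hμpos := hμ0.trans_le hμ.1
    have hμz : μ • z s = (μ * f s) • c s := smul_smul _ _ _
    have hyX := smul_mem (hX hzs) hμpos.le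
    have hybox : μ • z s ∈ box L r := by
      have hpf := mul_pos hμpos (hf s hs hs1).1
      obtain ⟨h1, h2⟩ := hbound _ s _ hs hs1 hpf hvt (by rw [← hμz]; exact hμu)
      rw [hμz]
      refine hbox _ fun l => ?_
      change lo ≤ (μ * f s) * c s l ∧ (μ * f s) * c s l ≤ hi
      have h3 : β / M ≤ μ * f s := by rw [div_le_iff₀ hM]; exact (hvβ t ht).trans h2
      have h4 : μ * f s ≤ α / m := by rw [le_div_iff₀ hm]; exact h1.trans (hvα t ht0)
      exact ⟨mul_le_mul h3 (hcm s hs hs1 l) hm.le hpf.le,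
        mul_le_mul h4 (hcM s hs hs1 l) (hcpos s hs hs1 l).le hαm.le⟩
    have hxX := hdiagX hvt.le
    have hwX := hdiagX hvs.le
    have hind : Indiff R (v t • ones L) (μ • z s) := by
      have h1 := hu.diag _ hvt.le
      exact ⟨(hrep _ hxX _ hyX).2 (hμu.trans h1.symm).le, (hrep _ hyX _ hxX).2 (h1.trans hμu.symm).le⟩
    have hclose : ‖v t • ones L - v s • ones L‖ < ε := by
      rw [← sub_smul, norm_smul, Real.norm_eq_abs, abs_sub_comm, hvst, abs_of_pos hpos]
      have h1 : (t - s) * ((α - β) * ‖ones L‖ + 1) < ε := by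
        rw [← lt_div_iff₀ hden]; exact hd.trans_le (min_le_right _ _)
      nlinarith
    have hL := hlipr _ (hboxdiag t ht0 ht) _ hybox _ (hboxdiag s hs hs1) hind hclose
    have hzin : z s ∈ upperContour R (v s • ones L) :=
      ⟨hX hzs, (hrep _ (hX hzs) _ hwX).2 (by rw [huzs, hu.diag _ hvs.le])⟩
    have h1 := (le_infDist_diag (v' := v t) hu hrep hvs.le).trans hL
    have h2 := Metric.infDist_le_dist_of_mem (x := μ • z s) hzin
    have h3 : dist (μ • z s) (z s) = (1 - μ) * ‖z s‖ := by
      have : μ • z s - z s = (μ - 1) • z s := by rw [sub_smul, one_smul]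
      rw [dist_eq_norm, this, norm_smul, Real.norm_eq_abs, abs_sub_comm,
        abs_of_nonneg (by linarith [hμ.2])]
    have h4 : (1 - μ) * ‖z s‖ ≤ κ * (t - s) * (α / m * N) :=
      mul_le_mul (by linarith [hμ.1]) (hzN s hs hs1) (norm_nonneg _)
        (mul_nonneg hκ.le (sub_pos.2 hst).le)
    have h5 : (α - β) * (t - s) ≤ H * (κ * (t - s) * (α / m * N)) := by
      rw [← hvst]
      exact h1.trans (mul_le_mul_of_nonneg_left (h2.trans (h3.trans_le h4)) hH.le)
    have h6 := mul_lt_mul_of_pos_right hκD (sub_pos.2 hst)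
    linarith
  have hspeed : ∀ s t, 0 ≤ s → s < t → t ≤ 1 →
      ‖z t - z s‖ ≤ (α / m * M / m * N + α / m * ‖b - a‖) * (t - s) ∨ ∀ l, z t l < z s l := by
    intro s t hs hst ht
    rw [or_iff_not_imp_right]
    intro hnot
    push Not at hnot
    have hs1 := hst.le.trans ht
    have ht0 := hs.trans hst.le
    obtain ⟨hft, huzt⟩ := hf t ht0 ht
    obtain ⟨hfs, huzs⟩ := hf s hs hs1
    have hd := sub_pos.2 hst
    have hle : u (z t) ≤ u (z s) := by
      change u (f t • c t) ≤ u (f s • c s)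
      rw [huzt, huzs]
      have := hvsub s t
      have := mul_pos (sub_pos.2 hab) hd
      linarith
    have hct : c t = c s + (t - s) • (b - a) := by
      ext l
      simp [c]
      ring
    exact norm_smul_sub_smul_le hm hM.le hd hct
      (fun l => abs_le.2 ⟨by simp; linarith [hb l, hMa l], by simp; linarith [ha l, hMb l]⟩)
      (hcm t ht0 ht) (hcN t ht0 ht) hfs.le (hfα s hs hs1) hnot
      (exists_apply_le_of_le hu (hX (hzpos s hs hs1)) hle)
  have hκh : κ * h₀ ≤ 1 := by
    have : h₀ ≤ 1 := min_le_left _ _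
    nlinarith
  have := reflTransGen_undercut_of_curve hu hzpos hκ hh₀ hκh hdrop hspeed
  rwa [hz0, hz1] at this

end Bundle

/-! ### The main theorem -/

theorem theorem1 (L : ℕ) (R : Bundle L → Bundle L → Prop)
    (hR : Bundle.IsPreference R)
    (hcont : Bundle.ContinuousPref R)
    (hlip : Bundle.LipschitzianPref R)
    (hmono : Bundle.MonotonePref R)
    (hconv : Bundle.StrictlyConvexPref R)
    (p : ℕ → Bundle L)
    (hpos : ∀ k, p k ∈ Bundle.positiveOrthant L)
    (hdense : Bundle.positiveOrthant L ⊆ closure (Set.range p))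
    (x : ℕ → Bundle L)
    (hx : ∀ k, x k ∈ Bundle.demand R (p k))
    (a b : Bundle L)
    (ha : a ∈ Bundle.positiveOrthant L)
    (hb : b ∈ Bundle.positiveOrthant L) :
    Bundle.StrictPref R a b ↔ ∃ n : ℕ, Bundle.StrictlyRevealedPreferred p x n a b := by
  have haX := Bundle.consumptionSet_of_pos ha
  have hbX := Bundle.consumptionSet_of_pos hb
  -- With no goods there is a single bundle and all costs vanish, so both sides are false.
  rcases isEmpty_or_nonempty (Fin L) with hL | hL
  · constructor
    · rintro ⟨h1, h2⟩
      rw [Subsingleton.elim a b] at h1 h2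
      exact absurd h1 h2
    · rintro ⟨n, k, i, hk, -, -, h, -⟩
      have := h 0 hk
      simp [Bundle.inner_eq_sum] at this
  obtain ⟨u, hu, hrep⟩ := Bundle.exists_isRegularUtility hR hcont hmono hconv
  have hstrict : Bundle.StrictPref R a b ↔ u b < u a := by
    rw [Bundle.StrictPref, hrep a haX b hbX, hrep b hbX a haX, not_le]
    exact ⟨And.right, fun h => ⟨h.le, h⟩⟩
  rw [hstrict]
  refine ⟨fun hab => ?_, fun ⟨n, hn⟩ => hn.lt hu hrep hpos hx haX hbX⟩
  -- Moving `a` down and `b` up while keeping their ranking leaves room in every coordinate for the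
  -- approximating observations.
  obtain ⟨s, hs0, hs1, hs⟩ := hu.exists_smul_lt haX hab
  have hsa := Bundle.smul_pos_mem ha hs0
  obtain ⟨s', hs', hlt⟩ := hu.exists_one_lt_smul_lt hbX hs
  have hsb := Bundle.smul_pos_mem hb (one_pos.trans hs')
  refine Bundle.exists_strictlyRevealedPreferred hu hrep hdense hx (fun h => hlt.ne (by rw [h]))
    (fun l => mul_lt_of_lt_one_left (ha l) hs1) hsb (fun l => lt_mul_of_one_lt_left (hb l) hs')
    (Bundle.reflTransGen_undercut_of_lt hu hrep hlip hsa hsb hlt)
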